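/- Let $n\ge 3$ and let $Q_n$ be the $n$-dimensional hypercube, whose vertices are the binary strings of length $n$, two of them being adjacent iff they differ in exactly one bit; the parity of a vertex is the number of ones in it modulo $2$. Let $F$ be a set of (faulty) edges of $Q_n$; the other edges are called healthy, and $Q_n-F$ is the graph formed by the healthy edges. Call $F$ minimal if for every proper subset $G\subsetneq F$ the graph $Q_n-G$ has a Hamiltonian cycle. A nonempty proper subset $T$ of the vertex set of $Q_n$ is disconnected halfway by $F$ if for some $p\in\{0,1\}$ at least half of the vertices of $T$ have parity $p$, and every edge of $Q_n$ joining a vertex of parity $p$ in $T$ to a vertex outside $T$ is in $F$. Suppose that $F$ is minimal, that $T$ is disconnected halfway by $F$, and that no proper subset of $T$ is disconnected halfway by $F$. Then: 1. If $|T|=4$, then $T$ is a $Q_2$-DHW trap, that is, $T$ is (the vertex set of) a $2$-dimensional subcube of $Q_n$ all four of whose edges are healthy, and $T$ is disconnected halfway by $F$. 2. If $|T|=6$, then $T$ contains a cycle of length $6$ consisting of healthy edges. 3. If $|T|=8$, then $T$ contains a cycle of length $8$ consisting of healthy edges, or $Q_n$ has a CL (claw) trap, that is, there are a vertex $u$ and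 three distinct vertices $v,w,x$ such that the edges $(u,v),(u,w),(u,x)$ are healthy and each of $v,w,x$ has degree $2$ in $Q_n-F$. -/

import Mathlib

namespace FaultyCube

/-- Vertices of the `n`-dimensional hypercube: binary strings of length `n`. -/
abbrev Vert (n : ℕ) : Type := Fin n → Bool

/-- The hypercube `Q_n`: two strings are adjacent iff they differ in exactly one bit. -/
def cube (n : ℕ) : SimpleGraph (Vert n) where
  Adj x y := hammingDist x y = 1
  symm := ⟨fun x y h => by rw [hammingDist_comm]; exact h⟩
  loopless := ⟨fun x h => by simp at h⟩

/-- The parity (`0` or `1`) of a vertex: the number of ones in its label modulo `2`. -/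
def parity {n : ℕ} (x : Vert n) : ℕ :=
  (Finset.univ.filter fun i => x i = true).card % 2

/-- The cube `Q_n - F` formed by the healthy edges, where `F` is the set of faulty edges. -/
def healthy (n : ℕ) (F : Set (Sym2 (Vert n))) : SimpleGraph (Vert n) :=
  (cube n).deleteEdges F

/-- `F` precludes Hamiltonian cycles: `Q_n - F` has no Hamiltonian cycle. -/
def Precludes (n : ℕ) (F : Set (Sym2 (Vert n))) : Prop :=
  ¬ (healthy n F).IsHamiltonian

/-- `F` is a minimal set of faulty edges: no proper subset of `F` precludes
Hamiltonian cycles. -/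
def IsMinimal (n : ℕ) (F : Set (Sym2 (Vert n))) : Prop :=
  ∀ G : Set (Sym2 (Vert n)), G ⊂ F → ¬ Precludes n G

/-- At least half of the nodes of `T` have parity `p`, and all edges of the cube joining nodes of
parity `p` in `T` with nodes outside `T` are faulty. -/
def HalfCut {n : ℕ} (F : Set (Sym2 (Vert n))) (T : Finset (Vert n)) (p : ℕ) : Prop :=
  T.card ≤ 2 * (T.filter fun x => parity x = p).card ∧
    ∀ x ∈ T, parity x = p → ∀ y, y ∉ T → (cube n).Adj x y → s(x, y) ∈ F

/-- `T`, a nonempty proper set of vertices (identified with the subgraph it induces), is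
disconnected halfway by the faulty edges `F`. -/
def IsDHW {n : ℕ} (F : Set (Sym2 (Vert n))) (T : Finset (Vert n)) : Prop :=
  T.Nonempty ∧ T ≠ Finset.univ ∧ (HalfCut F T 0 ∨ HalfCut F T 1)

/-- `T` is (the vertex set of) a `k`-dimensional subcube: `k` coordinates are free and the others
are fixed. -/
def IsSubcube {n : ℕ} (k : ℕ) (T : Finset (Vert n)) : Prop :=
  ∃ (D : Finset (Fin n)) (b : Vert n), D.card = k ∧ ∀ x, x ∈ T ↔ ∀ i, i ∉ D → x i = b i

/-- `T` is a `Q_2`-DHW trap: a two-dimensional subcube whose edges are all healthy, and which is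
disconnected halfway. -/
def IsQ2DHW {n : ℕ} (F : Set (Sym2 (Vert n))) (T : Finset (Vert n)) : Prop :=
  IsSubcube 2 T ∧ (∀ x ∈ T, ∀ y ∈ T, (cube n).Adj x y → s(x, y) ∉ F) ∧ IsDHW F T

/-- There is a (healthy) cycle of length `k` all of whose vertices are in `T`. -/
def ContainsCycle {n : ℕ} (F : Set (Sym2 (Vert n))) (T : Finset (Vert n)) (k : ℕ) : Prop :=
  ∃ (v : Vert n) (c : (healthy n F).Walk v v),
    c.IsCycle ∧ c.length = k ∧ ∀ x ∈ c.support, x ∈ T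

/-- `Q_n` with faulty edges `F` has a CL (claw) trap: a node `u` joined by healthy edges to three
distinct nodes `v`, `w`, `x`, each of degree `2` in `Q_n - F`. -/
def HasCLTrap {n : ℕ} (F : Set (Sym2 (Vert n))) : Prop :=
  ∃ u v w x : Vert n, v ≠ w ∧ v ≠ x ∧ w ≠ x ∧
    ∀ y ∈ ({v, w, x} : Set (Vert n)),
      (healthy n F).Adj u y ∧ ((healthy n F).neighborSet y).ncard = 2

end FaultyCube

namespace FaultyCube

/-! ### Half cuts against Hamiltonian cycles -/

variable {n : ℕ} {F : Set (Sym2 (Vert n))} {T : Finset (Vert n)} {p : ℕ}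

/-! A half cut of parity `p` confines both cycle edges at each vertex of `A`, the parity-`p` part of
`T`, to the rest `B` of `T`. As `B` is no larger than `A`, these edges saturate `B`, so a
Hamiltonian cycle could not leave `T` (`precludes_of_halfCut`). By minimality, `F` is then exactly
the set of edges that the cut requires: edges inside `T` are healthy, and vertices of `A` have no
healthy edges leaving `T`. Minimality of `T` forces `|A| = |B|` and more than `|S|` neighbours in
`B` for every nonempty proper `S ⊂ A` (`exists_bipartition`).

What remains concerns small bipartite graphs with this strict Hall condition. For parts of size 2
the graph is a 4-cycle, which spans a square; for size 3 it is Hamiltonian; for size 4 it is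
Hamiltonian unless three vertices of `A` of degree 2 share a neighbour, which would need degree 3 in
the cycle. That is the claw, and degrees in `A` are degrees in `Q_n - F`. Sizes 3 and 4 are settled
by exhaustive evaluation on bit matrices. -/

theorem parity_ne_of_adj {x y : Vert n} (h : (cube n).Adj x y) : parity x ≠ parity y := by
  have h1 : hammingDist x y = 1 := h
  have key : (Finset.univ.filter fun i => x i = true).card
      + (Finset.univ.filter fun i => y i = true).card
      = hammingDist x y + 2 * (Finset.univ.filter fun i => x i = true ∧ y i = true).card := by
    simp only [hammingDist, Finset.card_filter, Finset.mul_sum, ← Finset.sum_add_distrib]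
    refine Finset.sum_congr rfl fun i _ => ?_
    cases x i <;> cases y i <;> simp
  unfold parity
  omega

theorem healthy_adj {x y : Vert n} :
    (healthy n F).Adj x y ↔ (cube n).Adj x y ∧ s(x, y) ∉ F := by
  simp [healthy, SimpleGraph.deleteEdges_adj]

/-- A half cut precludes Hamiltonian cycles: counting the cycle edges at the vertices of parity `p`
in `T` shows that the cycle cannot leave `T`. -/
theorem precludes_of_halfCut (hn : n ≠ 0) (hT : T.Nonempty) (hT' : T ≠ Finset.univ)
    (h : HalfCut F T p) : Precludes n F := by
  classical
  intro H
  obtain ⟨v, c, hc⟩ := H (by simp [hn])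
  set r : Vert n → Vert n → Prop := c.toSubgraph.Adj with hr
  have hsymm : ∀ x y, r x y → r y x := fun x y hxy => hxy.symm
  set N : Vert n → Finset (Vert n) := fun x => Finset.univ.filter (r x) with hN
  have hdeg : ∀ x, (N x).card = 2 := by
    intro x
    rw [← hc.isCycle.ncard_neighborSet_toSubgraph_eq_two (hc.mem_support x),
      ← Set.ncard_coe_finset]
    congr 1
    ext y
    simp [hN, hr, SimpleGraph.Subgraph.mem_neighborSet]
  set A := T.filter fun x => parity x = p with hA
  set B := T.filter fun x => ¬ parity x = p with hB
  have hcard : A.card + B.card = T.card := Finset.card_filter_add_card_filter_not _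
  have hBA : B.card ≤ A.card := by have h1 : T.card ≤ 2 * A.card := h.1; omega
  have hAN : ∀ a ∈ A, ∀ y, r a y → y ∈ B := by
    intro a ha y hay
    obtain ⟨haT, hap⟩ := Finset.mem_filter.1 ha
    obtain ⟨hadj, hF⟩ := healthy_adj.1 (c.toSubgraph.adj_sub hay)
    refine Finset.mem_filter.2 ⟨?_, fun hy => parity_ne_of_adj hadj (hap.trans hy.symm)⟩
    by_contra hyT
    exact hF (h.2 a haT hap y hyT hadj)
  have hsum : 2 * A.card = ∑ b ∈ B, (A.filter fun a => r a b).card := by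
    have := Finset.sum_card_bipartiteAbove_eq_sum_card_bipartiteBelow (s := A) (t := B) r
    simp only [Finset.bipartiteAbove, Finset.bipartiteBelow] at this
    rw [← this, Finset.sum_congr rfl (g := fun _ => 2), Finset.sum_const, smul_eq_mul, mul_comm]
    intro a ha
    rw [← hdeg a]
    congr 1
    ext y
    simp only [hN, Finset.mem_filter, Finset.mem_univ, true_and]
    exact ⟨fun hy => hy.2, fun hy => ⟨hAN a ha y hy, hy⟩⟩
  have hsub : ∀ b, (A.filter fun a => r a b) ⊆ N b := fun b a ha =>
    Finset.mem_filter.2 ⟨Finset.mem_univ _, hsymm _ _ (Finset.mem_filter.1 ha).2⟩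
  have hle : ∀ b, (A.filter fun a => r a b).card ≤ 2 := fun b =>
    (Finset.card_le_card (hsub b)).trans (hdeg b).le
  -- The `2|A|` cycle edges at `A` all end in `B`, where each vertex absorbs at most 2; as `|B| ≤
  -- |A|`, every vertex of `B` is saturated.
  have hBN : ∀ b ∈ B, ∀ y, r b y → y ∈ A := by
    intro b hb y hby
    have heq : (A.filter fun a => r a b).card = 2 := by
      refine (hle b).eq_of_not_lt fun hlt => ?_
      have := Finset.sum_lt_sum (s := B) (fun i _ => hle i) ⟨b, hb, hlt⟩
      rw [Finset.sum_const, smul_eq_mul] at this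
      omega
    have hset := Finset.eq_of_subset_of_card_le (hsub b) (by rw [hdeg, heq])
    have : y ∈ N b := by simp [hN, hby]
    rw [← hset] at this
    exact (Finset.mem_filter.1 this).1
  have hclosed : ∀ x y, r x y → x ∈ T → y ∈ T := by
    intro x y hxy hx
    by_cases hp : parity x = p
    · exact (Finset.mem_filter.1 (hAN x (Finset.mem_filter.2 ⟨hx, hp⟩) y hxy)).1
    · exact (Finset.mem_filter.1 (hBN x (Finset.mem_filter.2 ⟨hx, hp⟩) y hxy)).1
  have hconn := c.toSubgraph_connected
  obtain ⟨x, hx⟩ := hT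
  refine hT' (Finset.eq_univ_of_forall fun y => ?_)
  have hmem : ∀ z, z ∈ c.toSubgraph.verts := fun z =>
    c.mem_verts_toSubgraph.2 (hc.mem_support z)
  obtain ⟨w⟩ := hconn.coe.preconnected ⟨x, hmem x⟩ ⟨y, hmem y⟩
  have : ∀ (s t : c.toSubgraph.verts) (_ : c.toSubgraph.coe.Walk s t), s.1 ∈ T → t.1 ∈ T := by
    intro s t w
    induction w with
    | nil => exact id
    | cons hadj _ ih => exact fun hs => ih (hclosed _ _ hadj hs)
  exact this _ _ w hx

/-- If `F` is minimal, it consists only of the edges that a half cut requires. -/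
theorem exists_of_mem_of_halfCut (hn : n ≠ 0) (hmin : IsMinimal n F) (hT : T.Nonempty)
    (hT' : T ≠ Finset.univ) (h : HalfCut F T p) {e : Sym2 (Vert n)} (he : e ∈ F) :
    ∃ x y, x ∈ T ∧ parity x = p ∧ y ∉ T ∧ e = s(x, y) := by
  by_contra hne
  push Not at hne
  -- Removing an edge that the cut does not require leaves the cut intact, so `F \ {e}` would still
  -- preclude.
  refine hmin (F \ {e}) ⟨Set.sdiff_subset, fun hs => (hs he).2 rfl⟩
    (precludes_of_halfCut hn hT hT' ⟨h.1, fun x hx hp y hy hadj => ⟨h.2 x hx hp y hy hadj, ?_⟩⟩)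
  rintro heq
  exact hne x y hx hp hy heq.symm

theorem isDHW_of_ssubset (hT' : T ≠ Finset.univ) {p : ℕ} (hp : p = 0 ∨ p = 1)
    {T' : Finset (Vert n)} (hss : T' ⊂ T) (hne : T'.Nonempty) (h : HalfCut F T' p) :
    IsDHW F T' := by
  refine ⟨hne, fun h => ?_, ?_⟩
  · exact hT' (Finset.univ_subset_iff.1 (h ▸ hss.1))
  · rcases hp with rfl | rfl
    · exact Or.inl h
    · exact Or.inr h

/-- The structure of an inclusion-minimal set disconnected halfway: as many vertices `a i` of the
one parity as vertices `b j` of the other, all its edges healthy, no further healthy edge at `a i`,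
and a strict form of Hall's condition. -/
theorem exists_bipartition (hn : n ≠ 0) (hmin : IsMinimal n F) (hT : IsDHW F T)
    (hsub : ∀ T' : Finset (Vert n), T' ⊂ T → ¬ IsDHW F T') {k : ℕ} (hk : T.card = 2 * k) :
    ∃ a b : Fin k → Vert n, Function.Injective a ∧ Function.Injective b ∧ (∀ i j, a i ≠ b j) ∧
      (∀ x, x ∈ T ↔ (∃ i, x = a i) ∨ ∃ j, x = b j) ∧
      (∀ x ∈ T, ∀ y ∈ T, (cube n).Adj x y → s(x, y) ∉ F) ∧
      (∀ i y, (healthy n F).Adj (a i) y ↔ ∃ j, y = b j ∧ (cube n).Adj (a i) (b j)) ∧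
      ∀ S : Finset (Fin k), S.Nonempty → S ≠ Finset.univ →
        S.card < {j | ∃ i ∈ S, (cube n).Adj (a i) (b j)}.ncard := by
  classical
  obtain ⟨hne, hT', h01⟩ := hT
  obtain ⟨p, hp, h⟩ : ∃ p, (p = 0 ∨ p = 1) ∧ HalfCut F T p := by
    rcases h01 with h | h
    · exact ⟨0, Or.inl rfl, h⟩
    · exact ⟨1, Or.inr rfl, h⟩
  have hmem : ∀ {e}, e ∈ F → ∃ x y, x ∈ T ∧ parity x = p ∧ y ∉ T ∧ e = s(x, y) :=
    fun he => exists_of_mem_of_halfCut hn hmin hne hT' h he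
  set A := T.filter fun x => parity x = p with hA
  set B := T.filter fun x => ¬ parity x = p with hB
  have hcard : A.card + B.card = T.card := Finset.card_filter_add_card_filter_not _
  have hBA : B.card ≤ A.card := by have h1 : T.card ≤ 2 * A.card := h.1; omega
  -- Otherwise a vertex of `A` can be dropped: the neighbours of the remaining ones have the other
  -- parity, so no new edge is cut.
  have hAB : A.card ≤ B.card := by
    by_contra hlt
    push Not at hlt
    obtain ⟨a, ha⟩ : A.Nonempty := Finset.card_pos.1 (by omega)
    obtain ⟨haT, hap⟩ := Finset.mem_filter.1 ha
    have h1 : T.card ≤ 2 * A.card := h.1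
    have hc : (T.erase a).card = T.card - 1 := Finset.card_erase_of_mem haT
    have hAc : ((T.erase a).filter fun x => parity x = p).card = A.card - 1 := by
      rw [Finset.filter_erase, Finset.card_erase_of_mem ha]
    refine hsub _ (Finset.erase_ssubset haT) (isDHW_of_ssubset hT' hp (Finset.erase_ssubset haT)
      (Finset.card_pos.1 (by omega)) ⟨by omega, fun x hx hxp y hy hadj => ?_⟩)
    refine h.2 x (Finset.mem_of_mem_erase hx) hxp y (fun hyT => hy ?_) hadj
    refine Finset.mem_erase.2 ⟨?_, hyT⟩
    rintro rfl
    exact parity_ne_of_adj hadj (hxp.trans hap.symm)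
  have hAk : A.card = k := by omega
  have hBk : B.card = k := by omega
  let ea := A.equivFinOfCardEq hAk
  let eb := B.equivFinOfCardEq hBk
  have haA : ∀ i, (ea.symm i).1 ∈ T ∧ parity (ea.symm i).1 = p := fun i =>
    Finset.mem_filter.1 (ea.symm i).2
  have hbB : ∀ i, (eb.symm i).1 ∈ T ∧ ¬ parity (eb.symm i).1 = p := fun i =>
    Finset.mem_filter.1 (eb.symm i).2
  have hBsurj : ∀ x ∈ T, ¬ parity x = p → ∃ j, x = (eb.symm j).1 := fun x hx hxp =>
    ⟨eb ⟨x, Finset.mem_filter.2 ⟨hx, hxp⟩⟩, by simp⟩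
  have hAsurj : ∀ x ∈ T, parity x = p → ∃ j, x = (ea.symm j).1 := fun x hx hxp =>
    ⟨ea ⟨x, Finset.mem_filter.2 ⟨hx, hxp⟩⟩, by simp⟩
  have hhealthy : ∀ x ∈ T, ∀ y ∈ T, (cube n).Adj x y → s(x, y) ∉ F := by
    intro x hx y hy _ hF
    obtain ⟨u, w, hu, -, hw, heq⟩ := hmem hF
    rcases Sym2.eq_iff.1 heq with ⟨rfl, rfl⟩ | ⟨rfl, rfl⟩
    · exact hw hy
    · exact hw hx
  refine ⟨fun i => (ea.symm i).1, fun i => (eb.symm i).1,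
    Subtype.val_injective.comp ea.symm.injective, Subtype.val_injective.comp eb.symm.injective,
    fun i j hij => (hbB j).2 ((congrArg parity hij).symm.trans (haA i).2), fun x => ⟨fun hx => ?_, ?_⟩, hhealthy,
    fun i y => ⟨fun hy => ?_, ?_⟩, fun S hS hSu => ?_⟩
  · by_cases hxp : parity x = p
    · exact Or.inl (hAsurj x hx hxp)
    · exact Or.inr (hBsurj x hx hxp)
  · rintro (⟨i, rfl⟩ | ⟨i, rfl⟩)
    · exact (haA i).1
    · exact (hbB i).1
  · obtain ⟨hadj, hF⟩ := healthy_adj.1 hy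
    have hyT : y ∈ T := by
      by_contra hyT
      exact hF (h.2 _ (haA i).1 (haA i).2 y hyT hadj)
    obtain ⟨j, rfl⟩ := hBsurj y hyT
      fun hyp => parity_ne_of_adj hadj ((haA i).2.trans hyp.symm)
    exact ⟨j, rfl, hadj⟩
  · rintro ⟨j, rfl, hadj⟩
    exact healthy_adj.2 ⟨hadj, hhealthy _ (haA i).1 _ (hbB j).1 hadj⟩
  · by_contra hlt
    push Not at hlt
    -- If Hall's condition fails strictly at `S`, then `S` with its neighbourhood `J` is a smaller
    -- half cut.
    set J : Finset (Fin k) :=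
      Finset.univ.filter fun j => ∃ i ∈ S, (cube n).Adj (ea.symm i).1 (eb.symm j).1 with hJ
    have hJc : J.card ≤ S.card := by
      refine le_trans (le_of_eq ?_) hlt
      rw [← Set.ncard_coe_finset]
      simp [hJ]
    let fa : Fin k ↪ Vert n := ⟨fun i => (ea.symm i).1,
      Subtype.val_injective.comp ea.symm.injective⟩
    let fb : Fin k ↪ Vert n := ⟨fun i => (eb.symm i).1,
      Subtype.val_injective.comp eb.symm.injective⟩
    set T' := S.map fa ∪ J.map fb with hT'def
    have hfilt : S.map fa ⊆ T'.filter fun x => parity x = p := by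
      intro x hx
      refine Finset.mem_filter.2 ⟨Finset.mem_union_left _ hx, ?_⟩
      obtain ⟨i, -, rfl⟩ := Finset.mem_map.1 hx
      exact (haA i).2
    have hss : T' ⊂ T := by
      refine ⟨?_, fun hle => hSu (Finset.eq_univ_of_forall fun i => ?_)⟩
      · refine Finset.union_subset ?_ ?_ <;> intro x hx <;>
          obtain ⟨i, -, rfl⟩ := Finset.mem_map.1 hx
        · exact (haA i).1
        · exact (hbB i).1
      · rcases Finset.mem_union.1 (hle (haA i).1) with hx | hx
        · exact (Finset.mem_map' fa).1 hx
        · obtain ⟨j, -, hj⟩ := Finset.mem_map.1 hx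
          exact absurd (haA i).2 (hj ▸ (hbB j).2)
    refine hsub T' hss (isDHW_of_ssubset hT' hp hss ((hS.map).mono Finset.subset_union_left)
      ⟨?_, fun x hx hxp y hy hadj => ?_⟩)
    · have h1 := Finset.card_le_card hfilt
      have h2 := Finset.card_union_le (S.map fa) (J.map fb)
      rw [← hT'def] at h2
      simp only [Finset.card_map] at h1 h2
      omega
    · refine h.2 x (hss.1 hx) hxp y (fun hyT => hy ?_) hadj
      obtain ⟨j, rfl⟩ := hBsurj y hyT fun hyp => parity_ne_of_adj hadj (hxp.trans hyp.symm)
      rcases Finset.mem_union.1 hx with hx | hx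
      · obtain ⟨i, hi, rfl⟩ := Finset.mem_map.1 hx
        refine Finset.mem_union_right _ ((Finset.mem_map' fb).2 ?_)
        exact Finset.mem_filter.2 ⟨Finset.mem_univ _, i, hi, hadj⟩
      · obtain ⟨i, -, rfl⟩ := Finset.mem_map.1 hx
        exact absurd hxp (hbB i).2

/-! ### Four-cycles as squares, and explicit longer cycles -/

theorem exists_coord_of_adj {x y : Vert n} (h : (cube n).Adj x y) :
    ∃ i, ∀ k, y k = if k = i then !x k else x k := by
  obtain ⟨i, hi⟩ := Finset.card_eq_one.1 (show hammingDist x y = 1 from h)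
  refine ⟨i, fun k => ?_⟩
  have hk : x k ≠ y k ↔ k = i := by
    rw [← Finset.mem_singleton, ← hi]
    simp
  by_cases h : k = i
  · have := hk.2 h
    rw [if_pos h]
    revert this
    cases x k <;> cases y k <;> simp
  · rw [if_neg h]
    by_contra hne
    exact h (hk.1 (Ne.symm hne))

/-- Both paths from `a 0` to `a 1` flip the same two coordinates: `{i, i'} = {j, j'}` with `i ≠ j`,
so `i' = j`. These two are the free coordinates. -/
theorem isSubcube_two_of_adj {a b : Fin 2 → Vert n} (ha : Function.Injective a)
    (hb : Function.Injective b) (hT : ∀ x, x ∈ T ↔ (∃ i, x = a i) ∨ ∃ j, x = b j)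
    (hadj : ∀ i j, (cube n).Adj (a i) (b j)) : IsSubcube 2 T := by
  obtain ⟨i, hi⟩ := exists_coord_of_adj (hadj 0 0)
  obtain ⟨j, hj⟩ := exists_coord_of_adj (hadj 0 1)
  obtain ⟨i', hi'⟩ := exists_coord_of_adj (hadj 1 0).symm
  obtain ⟨j', hj'⟩ := exists_coord_of_adj (hadj 1 1).symm
  have hij : i ≠ j := by
    rintro rfl
    exact absurd (hb (funext fun k => (hi k).trans (hj k).symm)) (by decide)
  have hii' : i' ≠ i := by
    rintro rfl
    refine absurd (ha (funext fun k => ?_) : (0 : Fin 2) = 1) (by decide)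
    rw [hi', hi]
    split_ifs <;> simp
  have hi'j : i' = j := by
    by_contra hne
    have h1 := (hi' i').symm.trans (hj' i')
    rw [if_pos rfl, hi, hj, if_neg hii', if_neg hne] at h1
    have h2 := (hi' j).symm.trans (hj' j)
    rw [if_neg (Ne.symm hne), hi, hj, if_neg hij.symm, if_pos rfl] at h2
    by_cases h3 : i' = j'
    · subst h3
      rw [if_neg (Ne.symm hne)] at h2
      revert h2
      cases a 0 j <;> simp
    · rw [if_neg h3] at h1
      revert h1
      cases a 0 i' <;> simp
  subst hi'j
  refine ⟨{i, i'}, a 0, Finset.card_pair hij, fun x => ?_⟩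
  rw [hT]
  simp only [Fin.exists_fin_two, Finset.mem_insert, Finset.mem_singleton, not_or]
  constructor
  · rintro ((rfl | rfl) | (rfl | rfl)) k ⟨h1, h2⟩
    · rfl
    · rw [hi', hi, if_neg h1, if_neg h2]
    · rw [hi, if_neg h1]
    · rw [hj, if_neg h2]
  · intro hx
    have hflip : ∀ {s t : Bool}, s ≠ t → s = !t := by decide
    by_cases h1 : x i = a 0 i <;> by_cases h2 : x i' = a 0 i'
    · refine Or.inl (Or.inl (funext fun k => ?_))
      by_cases hk : k = i
      · rw [hk, h1]
      · by_cases hk' : k = i'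
        · rw [hk', h2]
        · exact hx k ⟨hk, hk'⟩
    · refine Or.inr (Or.inr (funext fun k => ?_))
      rw [hj]
      split_ifs with hk'
      · rw [hk', hflip h2]
      · by_cases hk : k = i
        · rw [hk, h1]
        · exact hx k ⟨hk, hk'⟩
    · refine Or.inr (Or.inl (funext fun k => ?_))
      rw [hi]
      split_ifs with hk
      · rw [hk, hflip h1]
      · by_cases hk' : k = i'
        · rw [hk', h2]
        · exact hx k ⟨hk, hk'⟩
    · refine Or.inl (Or.inr (funext fun k => ?_))
      rw [hi', hi]
      by_cases hk : k = i
      · rw [if_neg (hk ▸ hij), if_pos hk, hk, hflip h1]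
      · by_cases hk' : k = i'
        · rw [if_pos hk', if_neg hk, hk', hflip h2]
        · rw [if_neg hk', if_neg hk, hx k ⟨hk, hk'⟩]

/-- The index `k + 1` wraps around in `Fin 3`, which closes the cycle `a 0, b 0, a 1, b 1, a 2, b
2`. -/
theorem containsCycle_six {a b : Fin 3 → Vert n} (ha : Function.Injective a)
    (hb : Function.Injective b) (hab : ∀ i j, a i ≠ b j) (haT : ∀ i, a i ∈ T) (hbT : ∀ i, b i ∈ T)
    (h : ∀ k, (healthy n F).Adj (a k) (b k) ∧ (healthy n F).Adj (a (k + 1)) (b k)) :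
    ContainsCycle F T 6 := by
  have hba : ∀ i j, b i ≠ a j := fun i j => (hab j i).symm
  refine ⟨a 0, .cons (h 0).1 <| .cons (h 0).2.symm <| .cons (h 1).1 <| .cons (h 1).2.symm <|
    .cons (h 2).1 <| .cons (h 2).2.symm .nil, ?_, by simp, by simp [haT, hbT]⟩
  rw [SimpleGraph.Walk.cons_isCycle_iff]
  simp [SimpleGraph.Walk.isPath_def, ha.eq_iff, hb.eq_iff, hab, hba]

theorem containsCycle_eight {a b : Fin 4 → Vert n} (ha : Function.Injective a)
    (hb : Function.Injective b) (hab : ∀ i j, a i ≠ b j) (haT : ∀ i, a i ∈ T) (hbT : ∀ i, b i ∈ T)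
    (h : ∀ k, (healthy n F).Adj (a k) (b k) ∧ (healthy n F).Adj (a (k + 1)) (b k)) :
    ContainsCycle F T 8 := by
  have hba : ∀ i j, b i ≠ a j := fun i j => (hab j i).symm
  refine ⟨a 0, .cons (h 0).1 <| .cons (h 0).2.symm <| .cons (h 1).1 <| .cons (h 1).2.symm <|
    .cons (h 2).1 <| .cons (h 2).2.symm <| .cons (h 3).1 <| .cons (h 3).2.symm .nil,
    ?_, by simp, by simp [haT, hbT]⟩
  rw [SimpleGraph.Walk.cons_isCycle_iff]
  simp [SimpleGraph.Walk.isPath_def, ha.eq_iff, hb.eq_iff, hab, hba]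

/-! ### Exhaustive check on 4 × 4 bit matrices -/

/-- At least two of four bits are set. -/
def two (a b c d : Bool) : Bool := (a && (b || c || d)) || (b && (c || d)) || (c && d)

/-- At least three of four bits are set. -/
def three (a b c d : Bool) : Bool := (a && b && (c || d)) || (c && d && (a || b))

/-- All four bits are set. -/
def four (a b c d : Bool) : Bool := a && b && c && d

/-- A `2 × 2` matrix of bits has a transversal. -/
def per₂ (a b c d : Bool) : Bool := (a && d) || (b && c)

/-- A `3 × 3` matrix of bits has a transversal. -/
def per₃ (a b c d e f g h i : Bool) : Bool :=
  (a && per₂ e f h i) || (b && per₂ d f g i) || (c && per₂ d e g h)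

/-- A `4 × 4` matrix of bits has a transversal. -/
def per₄ (a b c d e f g h i j k l m n o p : Bool) : Bool :=
  (a && per₃ f g h j k l n o p) || (b && per₃ e g h i k l m o p) ||
  (c && per₃ e f h i j l m n p) || (d && per₃ e f g i j k m n o)

/-- The rows, in their cyclic order, can be joined by distinct common columns. -/
def cyc (a b c d e f g h i j k l m n o p : Bool) : Bool :=
  per₄ (a && e) (b && f) (c && g) (d && h) (e && i) (f && j) (g && k) (h && l)
    (i && m) (j && n) (k && o) (l && p) (m && a) (n && b) (o && c) (p && d)

/-- Three rows with two bits each have a column in common. -/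
def claw (a b c d e f g h i j k l : Bool) : Bool :=
  !three a b c d && !three e f g h && !three i j k l &&
    (a && e && i || b && f && j || c && g && k || d && h && l)

/-- The strict form of Hall's condition for three of four rows. -/
def hall (a b c d e f g h i j k l : Bool) : Bool :=
  two a b c d && two e f g h && two i j k l && three (a || e) (b || f) (c || g) (d || h) &&
  three (a || i) (b || j) (c || k) (d || l) && three (e || i) (f || j) (g || k) (h || l) &&
  four (a || e || i) (b || f || j) (c || g || k) (d || h || l)

/-- Three cyclic orders of four rows, and the four choices of three rows for a claw. -/
def cycOrClaw (a b c d e f g h i j k l m n o p : Bool) : Bool :=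
  cyc a b c d e f g h i j k l m n o p || cyc a b c d e f g h m n o p i j k l ||
  cyc a b c d i j k l e f g h m n o p ||
  claw a b c d e f g h i j k l || claw a b c d e f g h m n o p || claw a b c d i j k l m n o p ||
  claw e f g h i j k l m n o p

/-- Quantification over four bits. -/
def forallBits (q : Bool → Bool → Bool → Bool → Bool) : Bool :=
  [true, false].all fun a => [true, false].all fun b => [true, false].all fun c =>
    [true, false].all fun d => q a b c d

theorem of_forallBits {q : Bool → Bool → Bool → Bool → Bool} (h : forallBits q = true)
    (a b c d : Bool) : q a b c d = true := by
  have hmem : ∀ a : Bool, a ∈ [true, false] := by decide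
  simp only [forallBits, List.all_eq_true] at h
  exact h a (hmem a) b (hmem b) c (hmem c) d (hmem d)

/-- Up to rotation and reversal four rows have only three cyclic orders, so `cycOrClaw` covers all
cycles. Hall's condition is tested as soon as the rows it mentions are chosen, which prunes the
enumeration. -/
theorem forallBits_cycOrClaw :
    (forallBits fun a b c d => !two a b c d || forallBits fun e f g h => !two e f g h ||
      forallBits fun i j k l => !hall a b c d e f g h i j k l ||
      forallBits fun m n o p => !hall a b c d e f g h m n o p || !hall a b c d i j k l m n o p ||
        !hall e f g h i j k l m n o p || cycOrClaw a b c d e f g h i j k l m n o p) = true := by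
  decide +kernel

theorem cycOrClaw_of_hall {a b c d e f g h i j k l m n o p : Bool}
    (h₁ : hall a b c d e f g h i j k l = true) (h₂ : hall a b c d e f g h m n o p = true)
    (h₃ : hall a b c d i j k l m n o p = true) (h₄ : hall e f g h i j k l m n o p = true) :
    cycOrClaw a b c d e f g h i j k l m n o p = true := by
  have ha : two a b c d = true ∧ two e f g h = true := by
    simp only [hall, Bool.and_eq_true] at h₁
    tauto
  have := of_forallBits forallBits_cycOrClaw a b c d
  rw [ha.1, Bool.not_true, Bool.false_or] at this
  have := of_forallBits this e f g h
  rw [ha.2, Bool.not_true, Bool.false_or] at this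
  have := of_forallBits this i j k l
  rw [h₁, Bool.not_true, Bool.false_or] at this
  have := of_forallBits this m n o p
  simpa only [h₂, h₃, h₄, Bool.not_true, Bool.false_or] using this

/-! ### From permanents to transversals -/

/-- Expansion along row 0: `p.succAbove` embeds the columns of the minor while avoiding `p`. -/
theorem exists_injective_cons {m : ℕ} {x : Fin (m + 1) → Fin (m + 1) → Bool} (p : Fin (m + 1))
    (hp : x 0 p = true)
    (h : ∃ j : Fin m → Fin m, Function.Injective j ∧
      ∀ k, x k.succ (p.succAbove (j k)) = true) :
    ∃ j : Fin (m + 1) → Fin (m + 1), Function.Injective j ∧ ∀ k, x k (j k) = true := by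
  obtain ⟨j, hj, hx⟩ := h
  refine ⟨Fin.cons p fun k => p.succAbove (j k), Fin.cons_injective_iff.2 ⟨?_, ?_⟩,
    Fin.cases hp hx⟩
  · rintro ⟨k, hk⟩
    exact Fin.succAbove_ne _ _ hk
  · exact Fin.succAbove_right_injective.comp hj

theorem exists_of_per₂ (x : Fin 2 → Fin 2 → Bool)
    (h : per₂ (x 0 0) (x 0 1) (x 1 0) (x 1 1) = true) :
    ∃ j : Fin 2 → Fin 2, Function.Injective j ∧ ∀ k, x k (j k) = true := by
  simp only [per₂, Bool.or_eq_true, Bool.and_eq_true] at h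
  rcases h with h | h
  · exact ⟨![0, 1], by decide, Fin.forall_fin_two.2 h⟩
  · exact ⟨![1, 0], by decide, Fin.forall_fin_two.2 h⟩

theorem exists_of_per₃ (x : Fin 3 → Fin 3 → Bool)
    (h : per₃ (x 0 0) (x 0 1) (x 0 2) (x 1 0) (x 1 1) (x 1 2) (x 2 0) (x 2 1) (x 2 2) = true) :
    ∃ j : Fin 3 → Fin 3, Function.Injective j ∧ ∀ k, x k (j k) = true := by
  simp only [per₃, Bool.or_eq_true, Bool.and_eq_true] at h
  rcases h with (h | h) | h
  · exact exists_injective_cons 0 h.1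
      (exists_of_per₂ (fun k l => x k.succ (Fin.succAbove 0 l)) h.2)
  · exact exists_injective_cons 1 h.1
      (exists_of_per₂ (fun k l => x k.succ (Fin.succAbove 1 l)) h.2)
  · exact exists_injective_cons 2 h.1
      (exists_of_per₂ (fun k l => x k.succ (Fin.succAbove 2 l)) h.2)

theorem exists_of_per₄ (x : Fin 4 → Fin 4 → Bool)
    (h : per₄ (x 0 0) (x 0 1) (x 0 2) (x 0 3) (x 1 0) (x 1 1) (x 1 2) (x 1 3)
      (x 2 0) (x 2 1) (x 2 2) (x 2 3) (x 3 0) (x 3 1) (x 3 2) (x 3 3) = true) :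
    ∃ j : Fin 4 → Fin 4, Function.Injective j ∧ ∀ k, x k (j k) = true := by
  simp only [per₄, Bool.or_eq_true, Bool.and_eq_true] at h
  rcases h with ((h | h) | h) | h
  · exact exists_injective_cons 0 h.1
      (exists_of_per₃ (fun k l => x k.succ (Fin.succAbove 0 l)) h.2)
  · exact exists_injective_cons 1 h.1
      (exists_of_per₃ (fun k l => x k.succ (Fin.succAbove 1 l)) h.2)
  · exact exists_injective_cons 2 h.1
      (exists_of_per₃ (fun k l => x k.succ (Fin.succAbove 2 l)) h.2)
  · exact exists_injective_cons 3 h.1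
      (exists_of_per₃ (fun k l => x k.succ (Fin.succAbove 3 l)) h.2)

theorem ncard_eq_sum {k : ℕ} {s : Set (Fin k)} {x : Fin k → Bool} (hx : ∀ j, x j = true ↔ j ∈ s) :
    s.ncard = ∑ j, (x j).toNat := by
  have : s = ((Finset.univ.filter fun j => x j = true : Finset (Fin k)) : Set (Fin k)) := by
    ext j
    simp [hx]
  rw [this, Set.ncard_coe_finset, Finset.card_filter]
  exact Finset.sum_congr rfl fun j _ => by cases x j <;> rfl

theorem bits_of_lt : ∀ a b c d : Bool,
    (1 < a.toNat + b.toNat + c.toNat + d.toNat → two a b c d = true) ∧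
    (2 < a.toNat + b.toNat + c.toNat + d.toNat → three a b c d = true) ∧
    (3 < a.toNat + b.toNat + c.toNat + d.toNat → four a b c d = true) := by
  decide

theorem sum_eq_two_of_bits : ∀ {a b c d : Bool}, two a b c d = true → three a b c d = false →
    a.toNat + b.toNat + c.toNat + d.toNat = 2 := by
  decide

/-! ### Hamiltonian cycles from the strict Hall condition -/

/-- A relation on three rows and three columns with the strict form of Hall's condition has a
Hamiltonian cycle. -/
theorem exists_hamiltonian_three (R : Fin 3 → Fin 3 → Prop)
    (hR : ∀ S : Finset (Fin 3), S.Nonempty → S ≠ Finset.univ →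
      S.card < {j | ∃ i ∈ S, R i j}.ncard) :
    ∃ j : Fin 3 → Fin 3, Function.Injective j ∧ ∀ k, R k (j k) ∧ R (k + 1) (j k) := by
  classical
  set x : Fin 3 → Fin 3 → Bool := fun i j => decide (R i j) with hx
  have h1 : ∀ i, 1 < (x i 0).toNat + (x i 1).toNat + (x i 2).toNat := by
    intro i
    have := hR {i} (by simp) (by revert i; decide)
    rwa [ncard_eq_sum (x := x i) (by simp [hx]), Fin.sum_univ_three] at this
  have h2 : ∀ i i', i ≠ i' →
      2 < (x i 0 || x i' 0).toNat + (x i 1 || x i' 1).toNat + (x i 2 || x i' 2).toNat := by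
    intro i i' hi
    have := hR {i, i'} (by simp) (by revert i i'; decide)
    rwa [ncard_eq_sum (x := fun j => x i j || x i' j) (by simp [hx]), Fin.sum_univ_three,
      Finset.card_pair hi] at this
  -- Row `k` of the matrix under `per₃` marks the columns common to rows `k` and `k + 1`; a
  -- transversal of it is a Hamiltonian cycle.
  have key : ∀ a b c d e f g h i : Bool, 1 < a.toNat + b.toNat + c.toNat →
      1 < d.toNat + e.toNat + f.toNat → 1 < g.toNat + h.toNat + i.toNat →
      2 < (a || d).toNat + (b || e).toNat + (c || f).toNat →
      2 < (a || g).toNat + (b || h).toNat + (c || i).toNat →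
      2 < (d || g).toNat + (e || h).toNat + (f || i).toNat →
      per₃ (a && d) (b && e) (c && f) (d && g) (e && h) (f && i) (g && a) (h && b) (i && c)
        = true := by
    decide
  obtain ⟨j, hj, hxj⟩ := exists_of_per₃ (fun k l => x k l && x (k + 1) l)
    (key _ _ _ _ _ _ _ _ _ (h1 0) (h1 1) (h1 2) (h2 0 1 (by decide)) (h2 0 2 (by decide))
      (h2 1 2 (by decide)))
  exact ⟨j, hj, fun k => by simpa [hx] using hxj k⟩

/-- A relation on four rows and four columns with the strict form of Hall's condition has a
Hamiltonian cycle, or a column related to three rows that are related to two columns each. -/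
theorem exists_hamiltonian_or_claw (R : Fin 4 → Fin 4 → Prop)
    (hR : ∀ S : Finset (Fin 4), S.Nonempty → S ≠ Finset.univ →
      S.card < {j | ∃ i ∈ S, R i j}.ncard) :
    (∃ i j : Fin 4 → Fin 4, Function.Injective i ∧ Function.Injective j ∧
      ∀ k, R (i k) (j k) ∧ R (i (k + 1)) (j k)) ∨
    ∃ (i : Fin 3 → Fin 4) (j : Fin 4), Function.Injective i ∧
      ∀ k, R (i k) j ∧ {l | R (i k) l}.ncard = 2 := by
  classical
  set x : Fin 4 → Fin 4 → Bool := fun i j => decide (R i j) with hx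
  have h1 : ∀ i, two (x i 0) (x i 1) (x i 2) (x i 3) = true := by
    intro i
    have := hR {i} (by simp) (by revert i; decide)
    rw [ncard_eq_sum (x := x i) (by simp [hx]), Fin.sum_univ_four] at this
    exact (bits_of_lt _ _ _ _).1 this
  have h2 : ∀ i i', i ≠ i' →
      three (x i 0 || x i' 0) (x i 1 || x i' 1) (x i 2 || x i' 2) (x i 3 || x i' 3) = true := by
    intro i i' hi
    have := hR {i, i'} (by simp) (by revert i i'; decide)
    rw [ncard_eq_sum (x := fun j => x i j || x i' j) (by simp [hx]), Fin.sum_univ_four,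
      Finset.card_pair hi] at this
    exact (bits_of_lt _ _ _ _).2.1 this
  have h3 : ∀ i i' i'', i ≠ i' → i ≠ i'' → i' ≠ i'' →
      four (x i 0 || x i' 0 || x i'' 0) (x i 1 || x i' 1 || x i'' 1)
        (x i 2 || x i' 2 || x i'' 2) (x i 3 || x i' 3 || x i'' 3) = true := by
    intro i i' i'' hi hi' hi''
    have hc : ({i, i', i''} : Finset (Fin 4)).card = 3 := Finset.card_eq_three.2
      ⟨i, i', i'', hi, hi', hi'', rfl⟩
    have := hR {i, i', i''} (by simp) (fun h => by rw [h] at hc; simp at hc)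
    rw [ncard_eq_sum (x := fun j => x i j || x i' j || x i'' j) (by simp [hx, or_assoc]),
      Fin.sum_univ_four, hc] at this
    exact (bits_of_lt _ _ _ _).2.2 this
  have hh : ∀ i i' i'', i ≠ i' → i ≠ i'' → i' ≠ i'' →
      hall (x i 0) (x i 1) (x i 2) (x i 3) (x i' 0) (x i' 1) (x i' 2) (x i' 3)
        (x i'' 0) (x i'' 1) (x i'' 2) (x i'' 3) = true := by
    intro i i' i'' hi hi' hi''
    simp only [hall, h1, h2 i i' hi, h2 i i'' hi', h2 i' i'' hi'', h3 i i' i'' hi hi' hi'',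
      Bool.and_true]
  have key := cycOrClaw_of_hall (hh 0 1 2 (by decide) (by decide) (by decide))
    (hh 0 1 3 (by decide) (by decide) (by decide)) (hh 0 2 3 (by decide) (by decide) (by decide))
    (hh 1 2 3 (by decide) (by decide) (by decide))
  have hcyc : ∀ i : Fin 4 → Fin 4, Function.Injective i →
      cyc (x (i 0) 0) (x (i 0) 1) (x (i 0) 2) (x (i 0) 3) (x (i 1) 0) (x (i 1) 1) (x (i 1) 2)
        (x (i 1) 3) (x (i 2) 0) (x (i 2) 1) (x (i 2) 2) (x (i 2) 3) (x (i 3) 0) (x (i 3) 1)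
        (x (i 3) 2) (x (i 3) 3) = true →
      ∃ i j : Fin 4 → Fin 4, Function.Injective i ∧ Function.Injective j ∧
        ∀ k, R (i k) (j k) ∧ R (i (k + 1)) (j k) := by
    intro i hi h
    obtain ⟨j, hj, hxj⟩ := exists_of_per₄ (fun k l => x (i k) l && x (i (k + 1)) l) h
    exact ⟨i, j, hi, hj, fun k => by simpa [hx] using hxj k⟩
  have hclaw : ∀ i : Fin 3 → Fin 4, Function.Injective i →
      claw (x (i 0) 0) (x (i 0) 1) (x (i 0) 2) (x (i 0) 3) (x (i 1) 0) (x (i 1) 1) (x (i 1) 2)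
        (x (i 1) 3) (x (i 2) 0) (x (i 2) 1) (x (i 2) 2) (x (i 2) 3) = true →
      ∃ (i : Fin 3 → Fin 4) (j : Fin 4), Function.Injective i ∧
        ∀ k, R (i k) j ∧ {l | R (i k) l}.ncard = 2 := by
    intro i hi h
    simp only [claw, Bool.and_eq_true, Bool.not_eq_true'] at h
    obtain ⟨⟨⟨h0, h1'⟩, h2'⟩, h⟩ := h
    have hcol : ∃ j, x (i 0) j = true ∧ x (i 1) j = true ∧ x (i 2) j = true := by
      simp only [Bool.or_eq_true, Bool.and_eq_true, and_assoc] at h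
      rcases h with ((h | h) | h) | h
      exacts [⟨0, h⟩, ⟨1, h⟩, ⟨2, h⟩, ⟨3, h⟩]
    obtain ⟨j, hj0, hj1, hj2⟩ := hcol
    have hthree : ∀ k, three (x (i k) 0) (x (i k) 1) (x (i k) 2) (x (i k) 3) = false :=
      Fin.forall_fin_succ.2 ⟨h0, Fin.forall_fin_two.2 ⟨h1', h2'⟩⟩
    have hj : ∀ k, x (i k) j = true := Fin.forall_fin_succ.2 ⟨hj0, Fin.forall_fin_two.2 ⟨hj1, hj2⟩⟩
    refine ⟨i, j, hi, fun k => ⟨by simpa [hx] using hj k, ?_⟩⟩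
    rw [ncard_eq_sum (x := x (i k)) (by simp [hx]), Fin.sum_univ_four]
    exact sum_eq_two_of_bits (h1 _) (hthree k)
  simp only [cycOrClaw, Bool.or_eq_true] at key
  rcases key with (((((h | h) | h) | h) | h) | h) | h
  · exact Or.inl (hcyc ![0, 1, 2, 3] (by decide) h)
  · exact Or.inl (hcyc ![0, 1, 3, 2] (by decide) h)
  · exact Or.inl (hcyc ![0, 2, 1, 3] (by decide) h)
  · exact Or.inr (hclaw ![0, 1, 2] (by decide) h)
  · exact Or.inr (hclaw ![0, 1, 3] (by decide) h)
  · exact Or.inr (hclaw ![0, 2, 3] (by decide) h)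
  · exact Or.inr (hclaw ![1, 2, 3] (by decide) h)

end FaultyCube

/-! ### The three cases -/

theorem mainTheorem1 (n : ℕ) (hn : 3 ≤ n)
    (F : Set (Sym2 (FaultyCube.Vert n))) (hF : F ⊆ (FaultyCube.cube n).edgeSet)
    (hmin : FaultyCube.IsMinimal n F)
    (T : Finset (FaultyCube.Vert n)) (hT : FaultyCube.IsDHW F T)
    (hsub : ∀ T' : Finset (FaultyCube.Vert n), T' ⊂ T → ¬ FaultyCube.IsDHW F T') :
    (T.card = 4 → FaultyCube.IsQ2DHW F T) ∧
    (T.card = 6 → FaultyCube.ContainsCycle F T 6) ∧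
    (T.card = 8 → FaultyCube.ContainsCycle F T 8 ∨ FaultyCube.HasCLTrap F) := by
  have hn0 : n ≠ 0 := by omega
  refine ⟨fun hc => ?_, fun hc => ?_, fun hc => ?_⟩
  · obtain ⟨a, b, ha, hb, -, hTab, hhealthy, -, hall⟩ :=
      FaultyCube.exists_bipartition hn0 hmin hT hsub (k := 2) hc
    refine ⟨FaultyCube.isSubcube_two_of_adj ha hb hTab fun i j => ?_, hhealthy, hT⟩
    have h := hall {i} (by simp) (by revert i; decide)
    by_contra hadj
    -- Hall at a singleton demands two neighbours, but a missing edge to `b j` leaves only one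
    -- candidate.
    have hle := Set.ncard_le_ncard (t := {j}ᶜ) (fun l hl => ?_ :
      {l | ∃ i' ∈ ({i} : Finset (Fin 2)), (FaultyCube.cube n).Adj (a i') (b l)} ⊆ {j}ᶜ)
    · rw [Set.ncard_compl, Set.ncard_singleton, Nat.card_fin] at hle
      rw [Finset.card_singleton] at h
      omega
    · rintro rfl
      obtain ⟨i', hi', hl⟩ := hl
      exact hadj (Finset.mem_singleton.1 hi' ▸ hl)
  · obtain ⟨a, b, ha, hb, hab, hTab, -, hadj, hall⟩ :=
      FaultyCube.exists_bipartition hn0 hmin hT hsub (k := 3) hc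
    obtain ⟨j, hj, h⟩ := FaultyCube.exists_hamiltonian_three _ hall
    exact FaultyCube.containsCycle_six ha (hb.comp hj) (fun _ _ => hab _ _)
      (fun i => (hTab _).2 (Or.inl ⟨i, rfl⟩)) (fun i => (hTab _).2 (Or.inr ⟨j i, rfl⟩))
      fun k => ⟨(hadj _ _).2 ⟨_, rfl, (h k).1⟩, (hadj _ _).2 ⟨_, rfl, (h k).2⟩⟩
  · obtain ⟨a, b, ha, hb, hab, hTab, -, hadj, hall⟩ :=
      FaultyCube.exists_bipartition hn0 hmin hT hsub (k := 4) hc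
    rcases FaultyCube.exists_hamiltonian_or_claw _ hall with ⟨i, j, hi, hj, h⟩ | ⟨i, j, hi, h⟩
    · exact Or.inl (FaultyCube.containsCycle_eight (ha.comp hi) (hb.comp hj) (fun _ _ => hab _ _)
        (fun k => (hTab _).2 (Or.inl ⟨i k, rfl⟩)) (fun k => (hTab _).2 (Or.inr ⟨j k, rfl⟩))
        fun k => ⟨(hadj _ _).2 ⟨_, rfl, (h k).1⟩, (hadj _ _).2 ⟨_, rfl, (h k).2⟩⟩)
    · have hai := ha.comp hi
      refine Or.inr ⟨b j, a (i 0), a (i 1), a (i 2), hai.ne (by decide), hai.ne (by decide),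
        hai.ne (by decide), fun y hy => ?_⟩
      obtain ⟨k, rfl⟩ : ∃ k, y = a (i k) := by
        rcases hy with rfl | rfl | rfl
        exacts [⟨0, rfl⟩, ⟨1, rfl⟩, ⟨2, rfl⟩]
      refine ⟨((hadj _ _).2 ⟨_, rfl, (h k).1⟩).symm, ?_⟩
      -- All healthy neighbours of `a (i k)` are among the `b l`, so the row count is its full
      -- healthy degree.
      rw [← (h k).2, ← Set.ncard_image_of_injective _ hb]
      congr 1
      ext y
      rw [SimpleGraph.mem_neighborSet, hadj]
      constructor
      · rintro ⟨l, rfl, hl⟩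
        exact ⟨l, hl, rfl⟩
      · rintro ⟨l, hl, rfl⟩
        exact ⟨l, rfl, hl⟩
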